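/- Let $\Bbbk$ be a field with $\operatorname{char}\Bbbk\neq 2$ and let $X$ be any set. An associative dialgebra is a $\Bbbk$-linear space with two bilinear operations $\vdash,\dashv$ such that $(a\dashv b)\vdash c=(a\vdash b)\vdash c$, $a\dashv(b\vdash c)=a\dashv(b\dashv c)$, $(a\vdash b)\vdash c=a\vdash(b\vdash c)$, $(a\dashv b)\dashv c=a\dashv(b\dashv c)$ and $(a\vdash b)\dashv c=a\vdash(b\dashv c)$. Let $\mathrm{DiAs}\langle X\rangle$ be the free associative dialgebra on $X$. Its basis consists of the dimonomials $x_1\cdots\dot x_i\cdots x_n$ ($n\ge 1$, $1\le i\le n$, $x_j\in X$), that is, the nonempty words in $X$ with one dotted (central) letter; $u\vdash v$ (respectively $u\dashv v$) is the concatenation of $u$ and $v$ in which only the dot of $v$ (respectively of $u$) is kept. Let $\mathrm{DiAs}\langle X\rangle^{(+)}$ be the same space with the operations $$a\vdash_{+} b=\tfrac12(a\vdash b+b\dashv a),\qquad a\dashv_{+} b=\tfrac12(a\dashv b+b\vdash a).$$ Let $\mathrm{DiAlg}\langle X\rangle$ be the free non-associative dialgebra on $X$ (two bilinear operations, no identities)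 and let $\mathcal J_{\mathrm{Di}}\colon\mathrm{DiAlg}\langle X\rangle\to\mathrm{DiAs}\langle X\rangle$ be the linear map that fixes each $x\in X$ and satisfies $\mathcal J_{\mathrm{Di}}(u\vdash v)=\mathcal J_{\mathrm{Di}}(u)\vdash_{+}\mathcal J_{\mathrm{Di}}(v)$ and $\mathcal J_{\mathrm{Di}}(u\dashv v)=\mathcal J_{\mathrm{Di}}(u)\dashv_{+}\mathcal J_{\mathrm{Di}}(v)$. Its image is denoted $\mathrm{DiSJ}\langle X\rangle$; its elements are the Jordan dipolynomials. Let $*$ be the linear map of $\mathrm{DiAs}\langle X\rangle$ that reverses dimonomials, $(x_1\cdots\dot x_i\cdots x_n)^*=x_n\cdots\dot x_i\cdots x_1$, put $\mathrm{DiHerm}\langle X\rangle=\{f\in\mathrm{DiAs}\langle X\rangle : f^*=f\}$, and write $\{u\}=u+u^*$ for a dimonomial $u$. **Theorem.** 1. $\mathrm{DiSJ}\langle X\rangle\subseteq\mathrm{DiHerm}\langle X\rangle$. 2. If $|X|\le 2$, then $\mathrm{DiSJ}\langle X\rangle=\mathrm{DiHerm}\langle X\rangle$. 3. If $|X|>2$,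 then the inclusion $\mathrm{DiSJ}\langle X\rangle\subsetneq\mathrm{DiHerm}\langle X\rangle$ is strict. 4. For every $X$, $\mathrm{DiHerm}\langle X\rangle$ is the subdialgebra of $\mathrm{DiAs}\langle X\rangle^{(+)}$ generated by $X$, the dotted tetrads $\{\dot xyzt\}$ with $x,y,z,t\in X$ pairwise distinct, and the dotted tetrads $\{\dot xxyz\}$ with $x,y,z\in X$ pairwise distinct. -/

import Mathlib

universe u v w

/-- A dialgebra structure on the `k`-module `V`: two bilinear operations, `vdash a b` being
`a ⊢ b` and `dashv a b` being `a ⊣ b`. -/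
structure Dialgebra (k : Type u) [Field k] (V : Type v) [AddCommGroup V] [Module k V] where
  vdash : V →ₗ[k] V →ₗ[k] V
  dashv : V →ₗ[k] V →ₗ[k] V

namespace Dialgebra

variable {k : Type u} [Field k] {V : Type v} [AddCommGroup V] [Module k V]

/-- The identities of associative dialgebras. -/
structure IsAssociative (D : Dialgebra k V) : Prop where
  zero_left : ∀ x y z, D.vdash (D.dashv x y) z = D.vdash (D.vdash x y) z
  zero_right : ∀ x y z, D.dashv x (D.vdash y z) = D.dashv x (D.dashv y z)
  assoc_vdash : ∀ x y z, D.vdash (D.vdash x y) z = D.vdash x (D.vdash y z)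
  assoc_dashv : ∀ x y z, D.dashv (D.dashv x y) z = D.dashv x (D.dashv y z)
  assoc_inner : ∀ x y z, D.dashv (D.vdash x y) z = D.vdash x (D.dashv y z)

/-- The dialgebra `D⁽⁺⁾`, whose operations are `½ (a ⊢ b + b ⊣ a)` and `½ (a ⊣ b + b ⊢ a)`. -/
noncomputable def plus (D : Dialgebra k V) : Dialgebra k V where
  vdash := (2 : k)⁻¹ • (D.vdash + D.dashv.flip)
  dashv := (2 : k)⁻¹ • (D.dashv + D.vdash.flip)

theorem plus_vdash (D : Dialgebra k V) (a b : V) :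
    D.plus.vdash a b = (2 : k)⁻¹ • (D.vdash a b + D.dashv b a) := by
  simp [plus]

theorem plus_dashv (D : Dialgebra k V) (a b : V) :
    D.plus.dashv a b = (2 : k)⁻¹ • (D.dashv a b + D.vdash b a) := by
  simp [plus]

/-- The subspace `W` is a subdialgebra of `D`. -/
def IsSubdialgebra (D : Dialgebra k V) (W : Submodule k V) : Prop :=
  ∀ a ∈ W, ∀ b ∈ W, D.vdash a b ∈ W ∧ D.dashv a b ∈ W

/-- The subdialgebra of `D` generated by the set `S`. -/
def generatedBy (D : Dialgebra k V) (S : Set V) : Submodule k V :=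
  sInf {W | S ⊆ W ∧ D.IsSubdialgebra W}

theorem subset_generatedBy (D : Dialgebra k V) (S : Set V) : S ⊆ D.generatedBy S := by
  intro s hs
  simp only [generatedBy, SetLike.mem_coe, Submodule.mem_sInf]
  exact fun W hW => hW.1 hs

theorem isSubdialgebra_generatedBy (D : Dialgebra k V) (S : Set V) :
    D.IsSubdialgebra (D.generatedBy S) := by
  intro a ha b hb
  simp only [generatedBy, Submodule.mem_sInf] at ha hb ⊢
  exact ⟨fun W hW => (hW.2 a (ha W hW) b (hb W hW)).1,
    fun W hW => (hW.2 a (ha W hW) b (hb W hW)).2⟩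

/-- `φ` is a homomorphism of dialgebras. -/
def IsHom {V' : Type w} [AddCommGroup V'] [Module k V'] (D : Dialgebra k V)
    (D' : Dialgebra k V') (φ : V →ₗ[k] V') : Prop :=
  ∀ a b, φ (D.vdash a b) = D'.vdash (φ a) (φ b) ∧ φ (D.dashv a b) = D'.dashv (φ a) (φ b)

/-- The linear map `s` is an involution of the dialgebra `D`. -/
structure IsInvolution (D : Dialgebra k V) (s : V →ₗ[k] V) : Prop where
  invol : ∀ a, s (s a) = a
  vdash : ∀ a b, s (D.vdash a b) = D.dashv (s b) (s a)
  dashv : ∀ a b, s (D.dashv a b) = D.vdash (s b) (s a)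

/-- The subspace of elements that are symmetric with respect to `s`. -/
def symmetricElements (s : V →ₗ[k] V) : Submodule k V where
  carrier := {a | s a = a}
  add_mem' := by
    intro a b ha hb
    simp only [Set.mem_ofPred_eq] at *
    rw [map_add, ha, hb]
  zero_mem' := by simp
  smul_mem' := by
    intro c a ha
    simp only [Set.mem_ofPred_eq] at *
    rw [map_smul, ha]

theorem mem_symmetricElements {s : V →ₗ[k] V} {a : V} :
    a ∈ symmetricElements s ↔ s a = a := Iff.rfl

theorem IsInvolution.isSubdialgebra {D : Dialgebra k V} {s : V →ₗ[k] V}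
    (h : D.IsInvolution s) : D.plus.IsSubdialgebra (symmetricElements s) := by
  intro a ha b hb
  rw [mem_symmetricElements] at ha hb
  simp only [mem_symmetricElements, plus_vdash, plus_dashv, map_smul, map_add, h.vdash, h.dashv,
    ha, hb]
  exact ⟨by rw [add_comm], by rw [add_comm]⟩

end Dialgebra

/-! ### The free (non-associative) dialgebra -/

/-- Bracketed words in the letters `X` with a choice of operation at every bracket. -/
inductive DiWord (X : Type v) : Type v
  | of : X → DiWord X
  | vdash : DiWord X → DiWord X → DiWord X
  | dashv : DiWord X → DiWord X → DiWord X

/-- The space `DiAlg⟨X⟩`, with basis `DiWord X`. -/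
abbrev DiAlg (k : Type u) [Field k] (X : Type v) : Type (max v u) := DiWord X →₀ k

namespace DiAlg

/-- The dialgebra structure of `DiAlg⟨X⟩`. -/
noncomputable def str (k : Type u) [Field k] (X : Type v) : Dialgebra k (DiAlg k X) where
  vdash := Finsupp.linearCombination k fun a : DiWord X =>
    Finsupp.linearCombination k fun b : DiWord X => Finsupp.single (a.vdash b) (1 : k)
  dashv := Finsupp.linearCombination k fun a : DiWord X =>
    Finsupp.linearCombination k fun b : DiWord X => Finsupp.single (a.dashv b) (1 : k)

end DiAlg

/-! ### The free associative dialgebra -/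

/-- The dimonomial `a₁ … ȧᵢ … aₙ`: the letters to the left of the central letter, the central
letter, and the letters to the right of it. -/
@[ext] structure Dimonomial (X : Type v) : Type v where
  left : List X
  center : X
  right : List X

namespace Dimonomial

variable {X : Type v}

/-- The underlying word, with the dot forgotten. -/
def word (a : Dimonomial X) : List X := a.left ++ a.center :: a.right

/-- `a ⊢ b`: concatenate and keep the dot of `b`. -/
def vdash (a b : Dimonomial X) : Dimonomial X := ⟨a.word ++ b.left, b.center, b.right⟩

/-- `a ⊣ b`: concatenate and keep the dot of `a`. -/
def dashv (a b : Dimonomial X) : Dimonomial X := ⟨a.left, a.center, a.right ++ b.word⟩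

/-- The reversed dimonomial. -/
def reverse (a : Dimonomial X) : Dimonomial X := ⟨a.right.reverse, a.center, a.left.reverse⟩

end Dimonomial

/-- The space `DiAs⟨X⟩`, with basis `Dimonomial X`. -/
abbrev DiAs (k : Type u) [Field k] (X : Type v) : Type (max v u) := Dimonomial X →₀ k

namespace DiAs

/-- The dialgebra structure of `DiAs⟨X⟩`. -/
noncomputable def str (k : Type u) [Field k] (X : Type v) : Dialgebra k (DiAs k X) where
  vdash := Finsupp.linearCombination k fun a : Dimonomial X =>
    Finsupp.linearCombination k fun b : Dimonomial X => Finsupp.single (a.vdash b) (1 : k)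
  dashv := Finsupp.linearCombination k fun a : Dimonomial X =>
    Finsupp.linearCombination k fun b : Dimonomial X => Finsupp.single (a.dashv b) (1 : k)

/-- A dimonomial as an element of `DiAs⟨X⟩`. -/
noncomputable def mono (k : Type u) [Field k] {X : Type v} (a : Dimonomial X) : DiAs k X :=
  Finsupp.single a 1

/-- The generator `x` of `DiAs⟨X⟩`. -/
noncomputable def gen (k : Type u) [Field k] {X : Type v} (x : X) : DiAs k X :=
  mono k ⟨[], x, []⟩

/-- The reversal involution `*` of `DiAs⟨X⟩`. -/
noncomputable def star (k : Type u) [Field k] (X : Type v) : DiAs k X →ₗ[k] DiAs k X :=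
  Finsupp.linearCombination k fun a : Dimonomial X => mono k a.reverse

/-- `{a} = a + a*` for a dimonomial `a`. -/
noncomputable def brace (k : Type u) [Field k] {X : Type v} (a : Dimonomial X) : DiAs k X :=
  mono k a + star k X (mono k a)

section basic

variable (k : Type u) [Field k] {X : Type v}

theorem vdash_mono (a b : Dimonomial X) :
    (str k X).vdash (mono k a) (mono k b) = mono k (a.vdash b) := by
  simp [str, mono]

theorem dashv_mono (a b : Dimonomial X) :
    (str k X).dashv (mono k a) (mono k b) = mono k (a.dashv b) := by
  simp [str, mono]

theorem star_mono (a : Dimonomial X) : star k X (mono k a) = mono k a.reverse := by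
  simp [star, mono]

theorem induction_mono {p : DiAs k X → Prop} (x : DiAs k X) (zero : p 0)
    (add : ∀ a b, p a → p b → p (a + b)) (smul : ∀ (c : k) a, p a → p (c • a))
    (mono' : ∀ a, p (mono k a)) : p x := by
  induction x using Finsupp.induction_linear with
  | zero => exact zero
  | add a b ha hb => exact add a b ha hb
  | single a c =>
    have := smul c _ (mono' a)
    simpa [mono] using this

theorem ext₁ {V : Type w} [AddCommGroup V] [Module k V] {f g : DiAs k X →ₗ[k] V}
    (h : ∀ a, f (mono k a) = g (mono k a)) (x : DiAs k X) : f x = g x := by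
  induction x using induction_mono with
  | zero => simp
  | add a b ha hb => rw [map_add, map_add, ha, hb]
  | smul c a ha => rw [map_smul, map_smul, ha]
  | mono' a => exact h a

theorem isAssociative : (str k X).IsAssociative := by
  constructor <;> intro x y z <;>
  (induction x using induction_mono with
    | zero => simp
    | add a b ha hb => simp only [map_add, LinearMap.add_apply, ha, hb]
    | smul c a ha => simp only [map_smul, LinearMap.smul_apply, ha]
    | mono' x =>
      induction y using induction_mono with
      | zero => simp
      | add a b ha hb => simp only [map_add, LinearMap.add_apply, ha, hb]
      | smul c a ha => simp only [map_smul, LinearMap.smul_apply, ha]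
      | mono' y =>
        induction z using induction_mono with
        | zero => simp
        | add a b ha hb => simp only [map_add, ha, hb]
        | smul c a ha => simp only [map_smul, ha]
        | mono' z =>
          simp [vdash_mono, dashv_mono, Dimonomial.vdash, Dimonomial.dashv, Dimonomial.word])

theorem isInvolution : (str k X).IsInvolution (star k X) := by
  refine ⟨fun x => ?_, fun x y => ?_, fun x y => ?_⟩
  · induction x using induction_mono with
    | zero => simp
    | add a b ha hb => simp only [map_add, ha, hb]
    | smul c a ha => simp only [map_smul, ha]
    | mono' x => simp [star_mono, Dimonomial.reverse]
  all_goals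
    induction x using induction_mono with
    | zero => simp
    | add a b ha hb => simp only [map_add, LinearMap.add_apply, ha, hb]
    | smul c a ha => simp only [map_smul, LinearMap.smul_apply, ha]
    | mono' x =>
      induction y using induction_mono with
      | zero => simp
      | add a b ha hb => simp only [map_add, LinearMap.add_apply, ha, hb]
      | smul c a ha => simp only [map_smul, LinearMap.smul_apply, ha]
      | mono' y =>
        simp [star_mono, vdash_mono, dashv_mono, Dimonomial.vdash, Dimonomial.dashv,
          Dimonomial.word, Dimonomial.reverse]

end basic

section free

variable {k : Type u} [Field k] {X : Type v} {V : Type w} [AddCommGroup V] [Module k V]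

/-- The value of a dimonomial under the substitution `f` of elements of `D` for the letters. -/
def evalMono (D : Dialgebra k V) (f : X → V) (a : Dimonomial X) : V :=
  a.left.foldr (fun x y => D.vdash (f x) y) (a.right.foldl (fun y x => D.dashv y (f x)) (f a.center))

theorem vdash_foldl {D : Dialgebra k V} (hD : D.IsAssociative) (f : X → V) (r : List X)
    (c z : V) : D.vdash (r.foldl (fun y x => D.dashv y (f x)) c) z =
      D.vdash c (r.foldr (fun x y => D.vdash (f x) y) z) := by
  induction r generalizing c with
  | nil => rfl
  | cons a r ih => simp only [List.foldl_cons, List.foldr_cons, ih, hD.zero_left, hD.assoc_vdash]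

theorem vdash_foldr {D : Dialgebra k V} (hD : D.IsAssociative) (f : X → V) (l : List X)
    (c z : V) : D.vdash (l.foldr (fun x y => D.vdash (f x) y) c) z =
      l.foldr (fun x y => D.vdash (f x) y) (D.vdash c z) := by
  induction l with
  | nil => rfl
  | cons a r ih => simp only [List.foldr_cons, ih, hD.assoc_vdash]

theorem dashv_foldr {D : Dialgebra k V} (hD : D.IsAssociative) (f : X → V) (l : List X)
    (c z : V) : D.dashv z (l.foldr (fun x y => D.vdash (f x) y) c) =
      D.dashv (l.foldl (fun y x => D.dashv y (f x)) z) c := by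
  induction l generalizing z with
  | nil => rfl
  | cons a r ih =>
    simp only [List.foldl_cons, List.foldr_cons, ← ih, hD.zero_right, hD.assoc_dashv]

theorem dashv_foldl {D : Dialgebra k V} (hD : D.IsAssociative) (f : X → V) (r : List X)
    (c z : V) : D.dashv z (r.foldl (fun y x => D.dashv y (f x)) c) =
      r.foldl (fun y x => D.dashv y (f x)) (D.dashv z c) := by
  induction r generalizing c with
  | nil => rfl
  | cons a r ih => simp only [List.foldl_cons, ih, hD.assoc_dashv]

theorem foldr_dashv {D : Dialgebra k V} (hD : D.IsAssociative) (f : X → V) (l : List X)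
    (c z : V) : D.dashv (l.foldr (fun x y => D.vdash (f x) y) c) z =
      l.foldr (fun x y => D.vdash (f x) y) (D.dashv c z) := by
  induction l with
  | nil => rfl
  | cons a r ih => simp only [List.foldr_cons, ih, hD.assoc_inner]

theorem evalMono_vdash {D : Dialgebra k V} (hD : D.IsAssociative) (f : X → V)
    (a b : Dimonomial X) :
    evalMono D f (a.vdash b) = D.vdash (evalMono D f a) (evalMono D f b) := by
  simp [evalMono, Dimonomial.vdash, Dimonomial.word, vdash_foldr hD, vdash_foldl hD]

theorem evalMono_dashv {D : Dialgebra k V} (hD : D.IsAssociative) (f : X → V)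
    (a b : Dimonomial X) :
    evalMono D f (a.dashv b) = D.dashv (evalMono D f a) (evalMono D f b) := by
  simp [evalMono, Dimonomial.dashv, Dimonomial.word, foldr_dashv hD, dashv_foldr hD,
    dashv_foldl hD]

/-- `DiAs⟨X⟩` is the free associative dialgebra on `X`. -/
theorem existsUnique_hom {D : Dialgebra k V} (hD : D.IsAssociative) (f : X → V) :
    ∃! φ : DiAs k X →ₗ[k] V, (str k X).IsHom D φ ∧ ∀ x, φ (gen k x) = f x := by
  have key : ∀ a, Finsupp.linearCombination k (evalMono D f) (mono k a) = evalMono D f a := by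
    intro a; simp [mono]
  refine ⟨Finsupp.linearCombination k (evalMono D f), ⟨fun a b => ?_, fun x => ?_⟩, ?_⟩
  · constructor <;>
    (induction a using induction_mono with
      | zero => simp
      | add a b ha hb => simp only [map_add, LinearMap.add_apply, ha, hb]
      | smul c a ha => simp only [map_smul, LinearMap.smul_apply, ha]
      | mono' a =>
        induction b using induction_mono with
        | zero => simp
        | add a b ha hb => simp only [map_add, ha, hb]
        | smul c a ha => simp only [map_smul, ha]
        | mono' b =>
          simp only [vdash_mono, dashv_mono, key, evalMono_vdash hD, evalMono_dashv hD])
  · rw [gen, key]; rfl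
  · rintro ψ ⟨hψ, hψ'⟩
    refine LinearMap.ext (ext₁ k fun a => ?_)
    rw [key]
    have hr : ∀ (r : List X) (c : X), ψ (mono k ⟨[], c, r⟩) =
        r.foldl (fun y x => D.dashv y (f x)) (f c) := by
      intro r c
      induction r using List.reverseRecOn with
      | nil => exact hψ' c
      | append_singleton r x ih =>
        have := (hψ (mono k ⟨[], c, r⟩) (gen k x)).2
        rw [gen, dashv_mono, ← gen, hψ' x, ih] at this
        simpa [Dimonomial.dashv, Dimonomial.word] using this
    obtain ⟨l, c, r⟩ := a
    induction l with
    | nil => exact hr r c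
    | cons x l ih =>
      have := (hψ (gen k x) (mono k ⟨l, c, r⟩)).1
      rw [gen, vdash_mono, ← gen, hψ' x, ih] at this
      simpa [Dimonomial.vdash, Dimonomial.word, evalMono] using this

end free

end DiAs

/-! ### Jordan dipolynomials and symmetric dipolynomials -/

/-- The value of a bracketed word in `DiAs⟨X⟩⁽⁺⁾`. -/
noncomputable def jordanWord (k : Type u) [Field k] {X : Type v} : DiWord X → DiAs k X
  | DiWord.of x => DiAs.gen k x
  | DiWord.vdash a b => (DiAs.str k X).plus.vdash (jordanWord k a) (jordanWord k b)
  | DiWord.dashv a b => (DiAs.str k X).plus.dashv (jordanWord k a) (jordanWord k b)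

/-- The linear map `DiAlg⟨X⟩ → DiAs⟨X⟩` that rewrites all products as Jordan products. -/
noncomputable def jordanMap (k : Type u) [Field k] (X : Type v) : DiAlg k X →ₗ[k] DiAs k X :=
  Finsupp.linearCombination k (jordanWord k)

theorem jordanMap_isHom (k : Type u) [Field k] (X : Type v) :
    (DiAlg.str k X).IsHom (DiAs.str k X).plus (jordanMap k X) := by
  intro a b
  constructor <;>
  (induction a using Finsupp.induction_linear with
    | zero => simp
    | add a b ha hb => simp only [map_add, LinearMap.add_apply, ha, hb]
    | single a c =>
      induction b using Finsupp.induction_linear with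
      | zero => simp
      | add a b ha hb => simp only [map_add, ha, hb]
      | single b d =>
        simp only [DiAlg.str, jordanMap, Finsupp.linearCombination_single, LinearMap.smul_apply,
          map_smul, one_smul, jordanWord, smul_comm c d])

/-- `DiSJ⟨X⟩`: the space of Jordan dipolynomials. -/
noncomputable def DiSJ (k : Type u) [Field k] (X : Type v) : Submodule k (DiAs k X) :=
  LinearMap.range (jordanMap k X)

/-- `DiHerm⟨X⟩`: the space of dipolynomials that are symmetric under `*`. -/
noncomputable def DiHerm (k : Type u) [Field k] (X : Type v) : Submodule k (DiAs k X) :=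
  Dialgebra.symmetricElements (DiAs.star k X)

/-- The dotted tetrads `{ẋyzt}` with `x`, `y`, `z`, `t` distinct. -/
def dottedTetrads (k : Type u) [Field k] (X : Type v) : Set (DiAs k X) :=
  {p | ∃ x y z t : X, [x, y, z, t].Nodup ∧ p = DiAs.brace k ⟨[], x, [y, z, t]⟩}

/-- The dotted tetrads `{ẋxyz}` with `x`, `y`, `z` distinct. -/
def dottedTetradsRepeated (k : Type u) [Field k] (X : Type v) : Set (DiAs k X) :=
  {p | ∃ x y z : X, [x, y, z].Nodup ∧ p = DiAs.brace k ⟨[], x, [x, y, z]⟩}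

/-!
The operations of `DiAs⟨X⟩⁽⁺⁾` are opposite to each other, and `a ⊢₊ b` depends on `a` only through
its undotted words. That symmetric elements form a subdialgebra is immediate; the content is in
generating them and in proving strictness. Both rest on treating a dimonomial as a word in tokens
`(letter, dotted or not)`, so that the dot travels with its letter.

*Generation.* Let `G` be a subdialgebra of `DiAs⟨X⟩⁽⁺⁾` containing `X`, and write `φ w` for the
class of `{w}` modulo `G`. If `{u}` and `{v}` lie in `G` for all dotted words of the lengths of `u`
and `v`, then expanding `{u} ⊢₊ {v}` gives
`φ (u v) + φ (u v*) + φ (u* v) + φ (u* v*) = 0` (`symClass_add_eq_zero`).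
For `u` a single token this says that a cyclic rotation changes the sign of `φ`; for `u` of length
two it then says that swapping the first two tokens does so too, and hence that swapping any two
neighbours does (`symClass_rotate`, `symClass_swap`). In length three the rotation is an
even permutation, so `φ = 0`. In length four `φ` is alternating, so only words whose tokens are
distinct survive; these are signed permutations of the dotted tetrads, where the dotted letter may
occur a second time without its dot. In length at least five, the relation for `u` of
length four reads `4 φ = 0`, once the length-four elements are in `G`. Since every symmetric element
`f` is `½ (f + f*)`, this gives `diHerm_le`, from which both equalities follow.

*Strictness.* For distinct `x`, `y`, `z` the linear functional `tetradForm` sends a word of length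
four to the determinant of the coordinates of its tokens with respect to `ẋ, x, y, z`, and every
other word to zero. It vanishes on letters and on `a ⊢₊ b` for symmetric `a`, by the alternation of
the determinant, but takes the value `2` on `{ẋxyz}`.
-/

/-! ### Alternating functions on words -/

section alternating

variable {Y : Type*} {Q : Type*} [AddCommGroup Q] {φ : List Y → Q} {n : ℕ}

/-- If rotations and swaps of the first two letters change the sign, so do swaps of any two
neighbouring letters: rotate them to the front. -/
theorem apply_swap_of_rotate (hrot : ∀ x w, w.length + 1 = n → φ (x :: w) = -φ (w ++ [x]))
    (hswap : ∀ x y w, w.length + 2 = n → φ (x :: y :: w) = -φ (y :: x :: w))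
    (u : List Y) (x y : Y) (w : List Y) (h : u.length + w.length + 2 = n) :
    φ (u ++ x :: y :: w) = -φ (u ++ y :: x :: w) := by
  induction u generalizing w with
  | nil => exact hswap x y w (by simpa using h)
  | cons a u ih =>
    have h' : u.length + w.length + 3 = n := by simp only [List.length_cons] at h; omega
    have := ih (w ++ [a]) (by simp; omega)
    rw [List.cons_append, List.cons_append, hrot, hrot]
    · rw [neg_inj]
      simpa using this
    · simp; omega
    · simp; omega

end alternating

/-! ### Dimonomials as words in tokens -/

namespace Dimonomial

variable {X : Type v}

/-- A word without a dot, as a word in tokens. -/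
def plainTokens (l : List X) : List (X × Bool) := l.map fun x => (x, false)

/-- A dimonomial as a word in the tokens `X × Bool`, the flag `true` marking the central letter. -/
def tokens (a : Dimonomial X) : List (X × Bool) :=
  plainTokens a.left ++ (a.center, true) :: plainTokens a.right

theorem tokens_injective : Function.Injective (tokens (X := X)) := by
  rintro ⟨l, c, r⟩ ⟨l', c', r'⟩ h
  have hmap : Function.Injective (List.map fun x : X => (x, false)) :=
    List.map_injective_iff.2 fun x y h => by simpa using h
  induction l generalizing l' with
  | nil =>
    cases l' with
    | nil =>
      simp only [tokens, plainTokens, List.map_nil, List.nil_append, List.cons.injEq,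
        Prod.mk.injEq] at h
      simp [h.1.1, hmap h.2]
    | cons b l' => simp [tokens, plainTokens] at h
  | cons b l ih =>
    cases l' with
    | nil => simp [tokens, plainTokens] at h
    | cons b' l' =>
      simp only [tokens, plainTokens, List.map_cons, List.cons_append, List.cons.injEq,
        Prod.mk.injEq, and_true] at h
      have := ih l' h.2
      simp only [Dimonomial.mk.injEq] at this ⊢
      simp [h.1, this]

theorem tokens_reverse (a : Dimonomial X) : a.reverse.tokens = a.tokens.reverse := by
  simp [tokens, plainTokens, reverse]

theorem reverse_reverse (a : Dimonomial X) : a.reverse.reverse = a := by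
  simp [reverse]

theorem word_reverse (a : Dimonomial X) : a.reverse.word = a.word.reverse := by
  simp [reverse, word]

theorem plainTokens_reverse (l : List X) : plainTokens l.reverse = (plainTokens l).reverse := by
  simp [plainTokens]

theorem tokens_vdash (a b : Dimonomial X) :
    (a.vdash b).tokens = plainTokens a.word ++ b.tokens := by
  simp [tokens, plainTokens, vdash]

theorem tokens_dashv (a b : Dimonomial X) :
    (a.dashv b).tokens = a.tokens ++ plainTokens b.word := by
  simp [tokens, plainTokens, dashv]

theorem reverse_vdash (a b : Dimonomial X) :
    (a.vdash b).reverse = b.reverse.dashv a.reverse := by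
  simp [vdash, dashv, reverse, word]

theorem length_tokens (a : Dimonomial X) : a.tokens.length = a.word.length := by
  simp [tokens, plainTokens, word]

theorem tokens_ne_nil (a : Dimonomial X) : a.tokens ≠ [] := by simp [tokens]

theorem plainTokens_word_ne_nil (a : Dimonomial X) : plainTokens a.word ≠ [] := by
  simp [plainTokens, word]

theorem exists_word_eq {l : List X} (h : l ≠ []) : ∃ a : Dimonomial X, a.word = l := by
  cases l with
  | nil => exact absurd rfl h
  | cons x l => exact ⟨⟨[], x, l⟩, rfl⟩

theorem exists_plainTokens_eq {w : List (X × Bool)} (h : w.countP (·.2) = 0) :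
    ∃ l, plainTokens l = w := by
  refine ⟨w.map Prod.fst, ?_⟩
  rw [plainTokens, List.map_map]
  refine (List.map_congr_left fun p hp => ?_).trans (List.map_id w)
  have := List.countP_eq_zero.1 h p hp
  ext <;> simp_all

theorem exists_tokens_eq {w : List (X × Bool)} (h : w.countP (·.2) = 1) :
    ∃ a : Dimonomial X, a.tokens = w := by
  induction w with
  | nil => simp at h
  | cons p w ih =>
    obtain ⟨x, b⟩ := p
    cases b with
    | false =>
      obtain ⟨⟨l, c, r⟩, rfl⟩ := ih (by simpa using h)
      exact ⟨⟨x :: l, c, r⟩, by simp [tokens, plainTokens]⟩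
    | true =>
      obtain ⟨l, rfl⟩ := exists_plainTokens_eq (w := w) (by simpa using h)
      exact ⟨⟨[], x, l⟩, by simp [tokens, plainTokens]⟩

theorem countP_tokens (a : Dimonomial X) : a.tokens.countP (·.2) = 1 := by
  simp [tokens, plainTokens, Function.comp_def]

end Dimonomial

namespace DiAs

variable (k : Type u) [Field k] {X : Type v}

/-- The element of `DiAs⟨X⟩` given by a word in tokens: a dimonomial if exactly one token is
dotted, and zero otherwise. With this convention the relations below hold for all words. -/
noncomputable def ofTokens : List (X × Bool) → DiAs k X :=
  Function.extend Dimonomial.tokens (mono k) 0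

theorem ofTokens_tokens (a : Dimonomial X) : ofTokens k a.tokens = mono k a :=
  Dimonomial.tokens_injective.extend_apply _ _ _

theorem ofTokens_eq_zero {w : List (X × Bool)} (h : w.countP (·.2) ≠ 1) :
    ofTokens k w = 0 := by
  rw [ofTokens, Function.extend_apply']
  · rfl
  · rintro ⟨a, rfl⟩
    exact h a.countP_tokens

/-- The four terms of `{a} ⊢₊ {b}`. -/
theorem plus_vdash_brace (a b : Dimonomial X) :
    (2 : k)⁻¹ • (brace k (a.vdash b) + brace k (a.vdash b.reverse) + brace k (a.reverse.vdash b)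
      + brace k (a.reverse.vdash b.reverse)) = (str k X).plus.vdash (brace k a) (brace k b) := by
  rw [Dialgebra.plus_vdash]
  simp only [brace, star_mono, map_add, LinearMap.add_apply, vdash_mono, dashv_mono,
    Dimonomial.reverse_vdash, Dimonomial.reverse_reverse]
  congr 1
  abel

/-! ### The symmetrized words modulo a subdialgebra -/

variable {k} (G : Submodule k (DiAs k X))

/-- The class of `{w}` modulo the subspace `G`. -/
noncomputable def symClass (w : List (X × Bool)) : DiAs k X ⧸ G :=
  G.mkQ (ofTokens k w + ofTokens k w.reverse)

theorem symClass_reverse (w : List (X × Bool)) : symClass G w.reverse = symClass G w := by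
  simp [symClass, add_comm]

theorem symClass_tokens (a : Dimonomial X) : symClass G a.tokens = G.mkQ (brace k a) := by
  rw [symClass, ← Dimonomial.tokens_reverse, ofTokens_tokens, ofTokens_tokens, brace, star_mono]

theorem symClass_tokens_eq_zero {a : Dimonomial X} :
    symClass G a.tokens = 0 ↔ brace k a ∈ G := by
  rw [symClass_tokens, Submodule.mkQ_apply, Submodule.Quotient.mk_eq_zero]

theorem symClass_eq_zero {w : List (X × Bool)} (h : w.countP (·.2) ≠ 1) :
    symClass G w = 0 := by
  rw [symClass, ofTokens_eq_zero k h, ofTokens_eq_zero k (by rwa [List.countP_reverse])]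
  simp

variable {G}

/-- Expanding the product `{u} ⊢₊ {v}`, or `{v} ⊢₊ {u}` if the dot is in `u`. -/
theorem symClass_add_eq_zero (h2 : (2 : k) ≠ 0) (hG : (str k X).plus.IsSubdialgebra G) {m : ℕ}
    (hm : ∀ a : Dimonomial X, a.word.length ≤ m → brace k a ∈ G) {u v : List (X × Bool)}
    (hu : u ≠ []) (hv : v ≠ []) (hum : u.length ≤ m) (hvm : v.length ≤ m) :
    symClass G (u ++ v) + symClass G (u ++ v.reverse) + symClass G (u.reverse ++ v)
      + symClass G (u.reverse ++ v.reverse) = 0 := by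
  have key : ∀ u v : List (X × Bool), u ≠ [] → u.length ≤ m → v.length ≤ m →
      u.countP (·.2) = 0 → v.countP (·.2) = 1 →
      symClass G (u ++ v) + symClass G (u ++ v.reverse) + symClass G (u.reverse ++ v)
        + symClass G (u.reverse ++ v.reverse) = 0 := by
    intro u v hu hum hvm hu0 hv1
    obtain ⟨l, rfl⟩ := Dimonomial.exists_plainTokens_eq hu0
    obtain ⟨a, rfl⟩ := Dimonomial.exists_word_eq (l := l)
      (by rintro rfl; simp [Dimonomial.plainTokens] at hu)
    obtain ⟨b, rfl⟩ := Dimonomial.exists_tokens_eq hv1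
    have hmem := (hG _ (hm a (by simpa [Dimonomial.plainTokens] using hum)) _
      (hm b (by rwa [Dimonomial.length_tokens] at hvm))).1
    rw [← plus_vdash_brace, Submodule.smul_mem_iff _ (inv_ne_zero h2)] at hmem
    simp only [← Dimonomial.plainTokens_reverse, ← Dimonomial.word_reverse,
      ← Dimonomial.tokens_reverse, ← Dimonomial.tokens_vdash, symClass_tokens, ← map_add]
    rwa [Submodule.mkQ_apply, Submodule.Quotient.mk_eq_zero]
  by_cases h : u.countP (·.2) + v.countP (·.2) = 1
  · rcases Nat.add_eq_one_iff.1 h with ⟨h0, h1⟩ | ⟨h1, h0⟩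
    · exact key u v hu hum hvm h0 h1
    · have := key v u hv hvm hum h0 h1
      rw [← symClass_reverse G (u ++ v), ← symClass_reverse G (u ++ v.reverse),
        ← symClass_reverse G (u.reverse ++ v), ← symClass_reverse G (u.reverse ++ v.reverse)]
      simp only [List.reverse_append, List.reverse_reverse]
      rw [← this]
      abel
  · rw [symClass_eq_zero, symClass_eq_zero, symClass_eq_zero, symClass_eq_zero]
    · simp
    all_goals simpa only [List.countP_append, List.countP_reverse] using h

theorem eq_zero_of_add_self_eq_zero (h2 : (2 : k) ≠ 0) {Q : Type*} [AddCommGroup Q] [Module k Q]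
    {x : Q} (h : x + x = 0) : x = 0 := by
  rw [← two_smul k] at h
  exact (smul_eq_zero.1 h).resolve_left h2

theorem symClass_rotate (h2 : (2 : k) ≠ 0) (hG : (str k X).plus.IsSubdialgebra G) {m : ℕ}
    (hm : ∀ a : Dimonomial X, a.word.length ≤ m → brace k a ∈ G) (x : X × Bool)
    (w : List (X × Bool)) (hw : w ≠ []) (hwm : w.length ≤ m) :
    symClass G (x :: w) = -symClass G (w ++ [x]) := by
  have hw' := List.length_pos_iff.2 hw
  have h := symClass_add_eq_zero h2 hG hm (u := [x]) (v := w) (by simp) hw (by simp; omega) hwm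
  have hr : symClass G (x :: w.reverse) = symClass G (w ++ [x]) := by
    rw [← symClass_reverse]; simp
  simp only [List.reverse_singleton, List.singleton_append, hr] at h
  rw [eq_neg_iff_add_eq_zero]
  apply eq_zero_of_add_self_eq_zero h2
  rw [← h]
  abel

theorem symClass_swap_head (h2 : (2 : k) ≠ 0) (hG : (str k X).plus.IsSubdialgebra G) {m : ℕ}
    (hm : ∀ a : Dimonomial X, a.word.length ≤ m → brace k a ∈ G) (x y : X × Bool)
    (w : List (X × Bool)) (hw : w ≠ []) (hwm : w.length + 1 ≤ m) :
    symClass G (x :: y :: w) = -symClass G (y :: x :: w) := by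
  have hw' := List.length_pos_iff.2 hw
  have h := symClass_add_eq_zero h2 hG hm (u := [x, y]) (v := w) (by simp) hw
    (by simp; omega) (by omega)
  -- Reversing and rotating twice turns `x y w*` into `y x w`.
  have hr : ∀ x y, symClass G (x :: y :: w.reverse) = symClass G (y :: x :: w) := by
    intro x y
    rw [symClass_rotate h2 hG hm y (x :: w) (by simp) (by simpa using hwm), List.cons_append,
      symClass_rotate h2 hG hm x (w ++ [y]) (by simp) (by simpa using hwm), neg_neg,
      ← symClass_reverse]
    simp
  simp only [List.reverse_cons, List.reverse_nil, List.nil_append, List.cons_append, hr] at h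
  rw [eq_neg_iff_add_eq_zero]
  apply eq_zero_of_add_self_eq_zero h2
  rw [← h]
  abel

theorem symClass_swap (h2 : (2 : k) ≠ 0) (hG : (str k X).plus.IsSubdialgebra G) {m : ℕ}
    (hm : ∀ a : Dimonomial X, a.word.length ≤ m → brace k a ∈ G) (hm2 : 2 ≤ m)
    (u : List (X × Bool)) (x y : X × Bool) (w : List (X × Bool))
    (h : u.length + w.length + 1 = m) :
    symClass G (u ++ x :: y :: w) = -symClass G (u ++ y :: x :: w) := by
  refine apply_swap_of_rotate (n := m + 1) (fun x w hw => ?_) (fun x y w hw => ?_) u x y w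
    (by omega)
  · exact symClass_rotate h2 hG hm x w (List.length_pos_iff.1 (by omega)) (by omega)
  · exact symClass_swap_head h2 hG hm x y w (List.length_pos_iff.1 (by omega)) (by omega)

/-! ### Words of length at most four -/

theorem brace_mem_of_length_le_one (hgen : ∀ x, gen k x ∈ G) (a : Dimonomial X)
    (ha : a.word.length ≤ 1) : brace k a ∈ G := by
  obtain ⟨l, c, r⟩ := a
  simp only [Dimonomial.word, List.length_append, List.length_cons] at ha
  obtain rfl := List.length_eq_zero_iff.1 (show l.length = 0 by omega)
  obtain rfl := List.length_eq_zero_iff.1 (show r.length = 0 by omega)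
  rw [brace, star_mono]
  exact G.add_mem (hgen c) (hgen c)

theorem brace_mem_of_length_le_succ {m : ℕ}
    (hm : ∀ a : Dimonomial X, a.word.length ≤ m → brace k a ∈ G)
    (h : ∀ w : List (X × Bool), w.length = m + 1 → symClass G w = 0) (a : Dimonomial X)
    (ha : a.word.length ≤ m + 1) : brace k a ∈ G := by
  rcases Nat.le_succ_iff.1 ha with ha | ha
  · exact hm a ha
  · exact symClass_tokens_eq_zero G |>.1 (h _ (by rwa [Dimonomial.length_tokens]))

theorem brace_mem_of_length_le_two (h2 : (2 : k) ≠ 0) (hG : (str k X).plus.IsSubdialgebra G)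
    (hgen : ∀ x, gen k x ∈ G) (a : Dimonomial X) (ha : a.word.length ≤ 2) : brace k a ∈ G := by
  have hm := brace_mem_of_length_le_one hgen
  refine brace_mem_of_length_le_succ hm (fun w hw => ?_) a ha
  obtain ⟨x, y, rfl⟩ := List.length_eq_two.1 hw
  have h := symClass_rotate h2 hG hm x [y] (by simp) (by simp)
  rw [← symClass_reverse G ([y] ++ [x])] at h
  exact eq_zero_of_add_self_eq_zero h2 (eq_neg_iff_add_eq_zero.1 h)

theorem brace_mem_of_length_le_three (h2 : (2 : k) ≠ 0)
    (hG : (str k X).plus.IsSubdialgebra G) (hgen : ∀ x, gen k x ∈ G) (a : Dimonomial X)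
    (ha : a.word.length ≤ 3) : brace k a ∈ G := by
  have hm := brace_mem_of_length_le_two h2 hG hgen
  refine brace_mem_of_length_le_succ hm (fun w hw => ?_) a ha
  obtain ⟨x, y, z, rfl⟩ := List.length_eq_three.1 hw
  -- A rotation of three letters is also a product of two swaps.
  have hr := symClass_rotate h2 hG hm x [y, z] (by simp) (by simp)
  have h₁ := symClass_swap h2 hG hm le_rfl [] x y [z] (by simp)
  have h₂ := symClass_swap h2 hG hm le_rfl [y] x z [] (by simp)
  simp only [List.nil_append, List.cons_append] at hr h₁ h₂
  rw [h₂, neg_neg] at h₁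
  rw [← h₁] at hr
  exact eq_zero_of_add_self_eq_zero h2 (eq_neg_iff_add_eq_zero.1 hr)

/-- In length four the classes alternate in the tokens, so it suffices to treat words that begin
with the dot and whose other letters are distinct, the dotted letter being new or equal to the
second one. -/
theorem brace_mem_of_length_le_four (h2 : (2 : k) ≠ 0)
    (hG : (str k X).plus.IsSubdialgebra G) (hgen : ∀ x, gen k x ∈ G)
    (h4 : ∀ x y z t : X, [y, z, t].Nodup → x = y ∨ x ∉ [y, z, t] →
      brace k ⟨[], x, [y, z, t]⟩ ∈ G)
    (a : Dimonomial X) (ha : a.word.length ≤ 4) : brace k a ∈ G := by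
  have hm := brace_mem_of_length_le_three h2 hG hgen
  refine brace_mem_of_length_le_succ hm (fun w hw => ?_) a ha
  have s₁ : ∀ p q r s, symClass G [p, q, r, s] = -symClass G [q, p, r, s] := fun p q r s =>
    symClass_swap h2 hG hm (by simp) [] p q [r, s] (by simp)
  have s₂ : ∀ p q r s, symClass G [p, q, r, s] = -symClass G [p, r, q, s] := fun p q r s =>
    symClass_swap h2 hG hm (by simp) [p] q r [s] (by simp)
  have s₃ : ∀ p q r s, symClass G [p, q, r, s] = -symClass G [p, q, s, r] := fun p q r s =>
    symClass_swap h2 hG hm (by simp) [p, q] r s [] (by simp)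
  have z₂ : ∀ p q s, symClass G [p, q, q, s] = 0 := fun p q s =>
    eq_zero_of_add_self_eq_zero h2 (eq_neg_iff_add_eq_zero.1 (s₂ p q q s))
  have z₃ : ∀ p q s, symClass G [p, q, s, s] = 0 := fun p q s =>
    eq_zero_of_add_self_eq_zero h2 (eq_neg_iff_add_eq_zero.1 (s₃ p q s s))
  have hcons : ∀ x y z t : X, [y, z, t].Nodup → x = y ∨ x ∉ [y, z, t] →
      symClass G [(x, true), (y, false), (z, false), (t, false)] = 0 := fun x y z t h h' =>
    (symClass_tokens_eq_zero G (a := ⟨[], x, [y, z, t]⟩)).2 (h4 x y z t h h')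
  have hdot : ∀ x y z t : X,
      symClass G [(x, true), (y, false), (z, false), (t, false)] = 0 := by
    intro x y z t
    by_cases hyz : y = z
    · rw [hyz, z₂]
    by_cases hzt : z = t
    · rw [hzt, z₃]
    by_cases hyt : y = t
    · rw [hyt, s₃, z₂, neg_zero]
    by_cases hxz : x = z
    · rw [s₂, hcons x z y t (by simp; tauto) (Or.inl hxz), neg_zero]
    by_cases hxt : x = t
    · rw [s₃, s₂, hcons x t y z (by simp; tauto) (Or.inl hxt), neg_zero, neg_zero]
    refine hcons x y z t (by simp; tauto) ?_
    simp
    tauto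
  by_cases hc : w.countP (·.2) = 1
  swap
  · exact symClass_eq_zero G hc
  obtain ⟨⟨p, b₁⟩, ⟨q, b₂⟩, ⟨r, b₃⟩, ⟨s, b₄⟩, rfl⟩ : ∃ p q r s, w = [p, q, r, s] := by
    match w, hw with
    | [p, q, r, s], _ => exact ⟨p, q, r, s, rfl⟩
  cases b₁ <;> cases b₂ <;> cases b₃ <;> cases b₄ <;> simp at hc
  · rw [s₃, s₂, s₁, hdot]; simp
  · rw [s₂, s₁, hdot]; simp
  · rw [s₁, hdot]; simp
  · exact hdot p q r s

/-! ### Words of arbitrary length -/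

/-- From length five on, `u = [a, b, c, d]` can be split off: the four terms of the relation
for `{u} ⊢₊ {v}` are even permutations of each other. -/
theorem brace_mem_of_le_four_of_mem (h2 : (2 : k) ≠ 0)
    (hG : (str k X).plus.IsSubdialgebra G)
    (h4 : ∀ a : Dimonomial X, a.word.length ≤ 4 → brace k a ∈ G)
    (m : ℕ) (a : Dimonomial X) (ha : a.word.length ≤ m + 4) : brace k a ∈ G := by
  induction m generalizing a with
  | zero => exact h4 a ha
  | succ m hm =>
    refine brace_mem_of_length_le_succ hm (fun w hw => ?_) a (by omega)
    obtain ⟨p, q, r, s, v, rfl⟩ : ∃ p q r s v, w = p :: q :: r :: s :: v := by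
      match w, hw with
      | p :: q :: r :: s :: v, _ => exact ⟨p, q, r, s, v, rfl⟩
    have hv : v.length = m + 1 := by simpa using hw
    have hv0 : v ≠ [] := List.length_pos_iff.1 (by omega)
    have hrel := symClass_add_eq_zero h2 hG hm (u := [p, q, r, s]) (v := v) (by simp) hv0
      (by simp) (by omega)
    have s₁ : ∀ p q r s, symClass G (p :: q :: r :: s :: v) = -symClass G (q :: p :: r :: s :: v) :=
      fun p q r s => symClass_swap h2 hG hm (by omega) [] p q (r :: s :: v) (by simp; omega)
    have s₂ : ∀ p q r s, symClass G (p :: q :: r :: s :: v) = -symClass G (p :: r :: q :: s :: v) :=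
      fun p q r s => symClass_swap h2 hG hm (by omega) [p] q r (s :: v) (by simp; omega)
    have s₃ : ∀ p q r s, symClass G (p :: q :: r :: s :: v) = -symClass G (p :: q :: s :: r :: v) :=
      fun p q r s => symClass_swap h2 hG hm (by omega) [p, q] r s v (by simp; omega)
    have hflip : symClass G (s :: r :: q :: p :: v) = symClass G (p :: q :: r :: s :: v) := by
      rw [s₁ s, s₂ r s, s₃ r q s, s₁ r q, s₂ q r, s₁ q p]
      simp
    have hrev : ∀ p q r s,
        symClass G (p :: q :: r :: s :: v.reverse) = symClass G (s :: r :: q :: p :: v) := by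
      intro p q r s
      rw [symClass_rotate h2 hG hm p _ (by simp) (by simp; omega), List.cons_append,
        symClass_rotate h2 hG hm q _ (by simp) (by simp; omega), List.cons_append, List.cons_append,
        symClass_rotate h2 hG hm r _ (by simp) (by simp; omega), List.cons_append, List.cons_append,
        List.cons_append, symClass_rotate h2 hG hm s _ (by simp) (by simp; omega), neg_neg, neg_neg,
        ← symClass_reverse]
      simp
    simp only [List.reverse_cons, List.reverse_nil, List.nil_append, List.cons_append, hrev,
      hflip] at hrel
    apply eq_zero_of_add_self_eq_zero h2
    apply eq_zero_of_add_self_eq_zero h2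
    rw [← hrel]
    abel

/-- A subdialgebra of `DiAs⟨X⟩⁽⁺⁾` that contains the letters and the dotted tetrads contains all
symmetric elements. -/
theorem diHerm_le (h2 : (2 : k) ≠ 0)
    (hG : (str k X).plus.IsSubdialgebra G) (hgen : ∀ x, gen k x ∈ G)
    (h4 : ∀ x y z t : X, [y, z, t].Nodup → x = y ∨ x ∉ [y, z, t] →
      brace k ⟨[], x, [y, z, t]⟩ ∈ G) : DiHerm k X ≤ G := by
  intro f hf
  have hbrace : ∀ a : Dimonomial X, brace k a ∈ G := fun a =>
    brace_mem_of_le_four_of_mem h2 hG (brace_mem_of_length_le_four h2 hG hgen h4)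
      a.word.length a (by omega)
  have hall : ∀ g : DiAs k X, g + star k X g ∈ G := by
    intro g
    induction g using induction_mono with
    | zero => simp
    | add a b ha hb =>
      rw [map_add, add_add_add_comm]
      exact G.add_mem ha hb
    | smul c a ha =>
      rw [map_smul, ← smul_add]
      exact G.smul_mem c ha
    | mono' a => exact hbrace a
  have := hall f
  rwa [show star k X f = f from hf, ← two_smul k, Submodule.smul_mem_iff _ h2] at this

/-! ### A functional that vanishes on Jordan dipolynomials -/

/-- The coordinates of a token with respect to `ẋ, x, y, z`, where the letters `x`, `y`, `z` are
assumed to be distinct. -/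
noncomputable def tokenCoord (k : Type u) [Field k] (x y z : X) (p : X × Bool) : Fin 4 → k :=
  open scoped Classical in
  ![if p = (x, true) then 1 else 0, if p = (x, false) then 1 else 0,
    if p = (y, false) then 1 else 0, if p = (z, false) then 1 else 0]

/-- The determinant of the coordinates of the tokens of a word of length four, and zero on
words of other lengths. -/
noncomputable def tokenDet (k : Type u) [Field k] (x y z : X) : List (X × Bool) → k
  | [p, q, r, s] => Matrix.det (Matrix.of ![tokenCoord k x y z p, tokenCoord k x y z q,
      tokenCoord k x y z r, tokenCoord k x y z s])
  | _ => 0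

theorem tokenDet_rotate (x y z : X) (p q r s : X × Bool) :
    tokenDet k x y z [q, r, s, p] = -tokenDet k x y z [p, q, r, s] := by
  simp only [tokenDet]
  generalize tokenCoord k x y z p = a
  generalize tokenCoord k x y z q = b
  generalize tokenCoord k x y z r = c
  generalize tokenCoord k x y z s = d
  simp [Matrix.det_succ_row_zero, Fin.sum_univ_succ, Fin.succAbove]
  ring

theorem tokenDet_swap (x y z : X) (p q r s : X × Bool) :
    tokenDet k x y z [q, p, r, s] = -tokenDet k x y z [p, q, r, s] := by
  simp only [tokenDet]
  generalize tokenCoord k x y z p = a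
  generalize tokenCoord k x y z q = b
  generalize tokenCoord k x y z r = c
  generalize tokenCoord k x y z s = d
  simp [Matrix.det_succ_row_zero, Fin.sum_univ_succ, Fin.succAbove]
  ring

/-- The symmetrized form of the vanishing of `tokenDet` on products of symmetric words: if one of
the factors has length one this is the sign of a rotation, if both have length two it is the sign
of a swap. -/
theorem tokenDet_add_eq_zero (x y z : X) {u v : List (X × Bool)} (hu : u ≠ []) (hv : v ≠ []) :
    tokenDet k x y z (u ++ v) + tokenDet k x y z (v ++ u) + tokenDet k x y z (u.reverse ++ v)
      + tokenDet k x y z (v ++ u.reverse) = 0 := by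
  by_cases h : u.length + v.length = 4
  · have hu' := List.length_pos_iff.2 hu
    have hv' := List.length_pos_iff.2 hv
    obtain hl | hl | hl : u.length = 1 ∨ u.length = 2 ∨ u.length = 3 := by omega
    · obtain ⟨p, rfl⟩ := List.length_eq_one_iff.1 hl
      obtain ⟨q, r, s, rfl⟩ := List.length_eq_three.1 (show v.length = 3 by omega)
      simp only [List.reverse_singleton, List.cons_append, List.nil_append]
      rw [tokenDet_rotate x y z p q r s]
      ring
    · obtain ⟨p, q, rfl⟩ := List.length_eq_two.1 hl
      obtain ⟨r, s, rfl⟩ := List.length_eq_two.1 (show v.length = 2 by omega)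
      simp only [List.reverse_cons, List.reverse_nil, List.cons_append, List.nil_append]
      rw [tokenDet_swap x y z p q, tokenDet_rotate x y z q r s p, tokenDet_rotate x y z p q r s,
        tokenDet_rotate x y z p r s q, tokenDet_rotate x y z q p r s, tokenDet_swap x y z p q]
      ring
    · obtain ⟨p, q, r, rfl⟩ := List.length_eq_three.1 hl
      obtain ⟨s, rfl⟩ := List.length_eq_one_iff.1 (show v.length = 1 by omega)
      simp only [List.reverse_cons, List.reverse_nil, List.cons_append, List.nil_append]
      rw [tokenDet_rotate x y z s p q r, tokenDet_rotate x y z s r q p]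
      ring
  · have h0 : ∀ w : List (X × Bool), w.length ≠ 4 → tokenDet k x y z w = 0 := by
      intro w hw
      unfold tokenDet
      split
      · simp at hw
      · rfl
    rw [h0, h0, h0, h0]
    · simp
    all_goals simp; omega

/-- The linear functional on `DiAs⟨X⟩` given by `tokenDet`. -/
noncomputable def tetradForm (k : Type u) [Field k] (x y z : X) : DiAs k X →ₗ[k] k :=
  Finsupp.linearCombination k fun a : Dimonomial X => tokenDet k x y z a.tokens

theorem tetradForm_mono (x y z : X) (a : Dimonomial X) :
    tetradForm k x y z (mono k a) = tokenDet k x y z a.tokens := by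
  simp [tetradForm, mono]

theorem tetradForm_gen (x y z c : X) : tetradForm k x y z (gen k c) = 0 := by
  rw [gen, tetradForm_mono]
  rfl

theorem tetradForm_symmetrized (x y z : X) (f g : DiAs k X) :
    tetradForm k x y z ((str k X).vdash f g + (str k X).dashv g f
      + (str k X).vdash (star k X f) g + (str k X).dashv g (star k X f)) = 0 := by
  simp only [map_add]
  induction f using induction_mono with
  | zero => simp
  | add a b ha hb =>
    simp only [map_add, LinearMap.add_apply] at ha hb ⊢
    linear_combination ha + hb
  | smul c a ha =>
    simp only [map_smul, LinearMap.smul_apply, smul_eq_mul] at ha ⊢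
    linear_combination c * ha
  | mono' a =>
    induction g using induction_mono with
    | zero => simp
    | add b c hb hc =>
      simp only [map_add, LinearMap.add_apply] at hb hc ⊢
      linear_combination hb + hc
    | smul c b hb =>
      simp only [map_smul, LinearMap.smul_apply, smul_eq_mul] at hb ⊢
      linear_combination c * hb
    | mono' b =>
      simp only [star_mono, vdash_mono, dashv_mono, tetradForm_mono, Dimonomial.tokens_vdash,
        Dimonomial.tokens_dashv, Dimonomial.word_reverse, Dimonomial.plainTokens_reverse]
      exact tokenDet_add_eq_zero x y z a.plainTokens_word_ne_nil b.tokens_ne_nil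

theorem tetradForm_plus_vdash (h2 : (2 : k) ≠ 0) (x y z : X) {f : DiAs k X} (hf : f ∈ DiHerm k X)
    (g : DiAs k X) : tetradForm k x y z ((str k X).plus.vdash f g) = 0 := by
  have h := tetradForm_symmetrized x y z f g
  rw [show star k X f = f from hf, add_assoc, map_add] at h
  rw [Dialgebra.plus_vdash, map_smul, eq_zero_of_add_self_eq_zero h2 h, smul_zero]

theorem plus_dashv_eq_plus_vdash (f g : DiAs k X) :
    (str k X).plus.dashv f g = (str k X).plus.vdash g f := by
  rw [Dialgebra.plus_dashv, Dialgebra.plus_vdash, add_comm]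

theorem tetradForm_brace {x y z : X} (h : [x, y, z].Nodup) :
    tetradForm k x y z (brace k ⟨[], x, [x, y, z]⟩) = 2 := by
  simp only [List.nodup_cons, List.mem_cons, not_or, List.not_mem_nil, not_false_eq_true,
    and_true, List.nodup_nil] at h
  obtain ⟨⟨hxy, hxz⟩, hyz⟩ := h
  rw [brace, star_mono, map_add, tetradForm_mono, tetradForm_mono]
  simp [Dimonomial.tokens, Dimonomial.plainTokens, Dimonomial.reverse, tokenDet, tokenCoord,
    Matrix.det_succ_row_zero, Fin.sum_univ_succ, Fin.succAbove, hxy, hxz, hyz, Ne.symm hxy,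
    Ne.symm hxz, Ne.symm hyz]
  norm_num

end DiAs

/-! ### Jordan dipolynomials and symmetric elements -/

section jordan

variable (k : Type u) [Field k] (X : Type v)

theorem brace_mem_diHerm {X : Type v} (a : Dimonomial X) : DiAs.brace k a ∈ DiHerm k X := by
  rw [DiHerm, Dialgebra.mem_symmetricElements, DiAs.brace, map_add, DiAs.isInvolution k |>.invol,
    add_comm]

theorem gen_mem_diHerm {X : Type v} (x : X) : DiAs.gen k x ∈ DiHerm k X := by
  rw [DiHerm, Dialgebra.mem_symmetricElements, DiAs.gen, DiAs.star_mono]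
  rfl

theorem jordanWord_mem_diHerm {X : Type v} (w : DiWord X) : jordanWord k w ∈ DiHerm k X := by
  have hsub := (DiAs.isInvolution k (X := X)).isSubdialgebra
  induction w with
  | of x => exact gen_mem_diHerm k x
  | vdash a b ha hb => exact (hsub _ ha _ hb).1
  | dashv a b ha hb => exact (hsub _ ha _ hb).2

theorem diSJ_eq_span : DiSJ k X = Submodule.span k (Set.range (jordanWord k)) :=
  Finsupp.range_linearCombination k

theorem diSJ_le_diHerm : DiSJ k X ≤ DiHerm k X := by
  rw [diSJ_eq_span, Submodule.span_le]
  rintro _ ⟨w, rfl⟩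
  exact jordanWord_mem_diHerm k w

theorem gen_mem_diSJ {X : Type v} (x : X) : DiAs.gen k x ∈ DiSJ k X := by
  rw [diSJ_eq_span]
  exact Submodule.subset_span ⟨DiWord.of x, rfl⟩

theorem isSubdialgebra_diSJ : (DiAs.str k X).plus.IsSubdialgebra (DiSJ k X) := by
  rintro _ ⟨a, rfl⟩ _ ⟨b, rfl⟩
  exact ⟨⟨_, (jordanMap_isHom k X a b).1⟩, ⟨_, (jordanMap_isHom k X a b).2⟩⟩

theorem tetradForm_eq_zero_of_mem_diSJ {k : Type u} [Field k] (h2 : (2 : k) ≠ 0) {X : Type v}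
    (x y z : X) {f : DiAs k X} (hf : f ∈ DiSJ k X) : DiAs.tetradForm k x y z f = 0 := by
  suffices h : DiSJ k X ≤ LinearMap.ker (DiAs.tetradForm k x y z) from h hf
  rw [diSJ_eq_span, Submodule.span_le]
  rintro _ ⟨w, rfl⟩
  rw [SetLike.mem_coe, LinearMap.mem_ker]
  cases w with
  | of c => exact DiAs.tetradForm_gen x y z c
  | vdash a b => exact DiAs.tetradForm_plus_vdash h2 x y z (jordanWord_mem_diHerm k a) _
  | dashv a b =>
    rw [jordanWord, DiAs.plus_dashv_eq_plus_vdash]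
    exact DiAs.tetradForm_plus_vdash h2 x y z (jordanWord_mem_diHerm k b) _

end jordan

theorem two_lt_mk_iff_exists_nodup {X : Type v} :
    2 < Cardinal.mk X ↔ ∃ x y z : X, [x, y, z].Nodup := by
  have h3 : 2 < Cardinal.mk X ↔ 3 ≤ Cardinal.mk X := by
    have := Cardinal.natCast_add_one_le_iff (n := 2) (c := Cardinal.mk X)
    norm_num at this
    exact this.symm
  refine ⟨fun h => ?_, fun ⟨x, y, z, h⟩ => ?_⟩
  · obtain ⟨x, y, hxy⟩ := Cardinal.two_le_iff.1 h.le
    obtain ⟨z, hzx, hzy⟩ := Cardinal.exists_ne_ne_of_three_le (h3.1 h) x y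
    exact ⟨x, y, z, by simp [hxy, hzx.symm, hzy.symm]⟩
  · have := Cardinal.mk_le_of_injective
      ((List.nodup_iff_injective_get.1 h).comp Equiv.ulift.{v, 0}.injective)
    rw [h3]
    simpa using this

theorem mainTheorem1 {k : Type u} [Field k] (hk : ringChar k ≠ 2) (X : Type v) :
    DiSJ k X ≤ DiHerm k X ∧
    (Cardinal.mk X ≤ 2 → DiSJ k X = DiHerm k X) ∧
    (2 < Cardinal.mk X → DiSJ k X < DiHerm k X) ∧
    DiHerm k X = (DiAs.str k X).plus.generatedBy
      (Set.range (DiAs.gen k (X := X)) ∪ dottedTetrads k X ∪ dottedTetradsRepeated k X) := by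
  have h2 : (2 : k) ≠ 0 := Ring.two_ne_zero hk
  refine ⟨diSJ_le_diHerm k X, fun hX => ?_, fun hX => ?_, ?_⟩
  · refine le_antisymm (diSJ_le_diHerm k X) (DiAs.diHerm_le h2 (isSubdialgebra_diSJ k X)
      (gen_mem_diSJ k) fun x y z t hyzt _ => absurd hX (not_le.2 ?_))
    -- Three distinct letters do not fit into `X`.
    exact two_lt_mk_iff_exists_nodup.2 ⟨y, z, t, hyzt⟩
  · obtain ⟨x, y, z, hxyz⟩ := two_lt_mk_iff_exists_nodup.1 hX
    refine lt_of_le_of_ne (diSJ_le_diHerm k X) fun heq => h2 ?_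
    rw [← DiAs.tetradForm_brace (k := k) hxyz]
    exact tetradForm_eq_zero_of_mem_diSJ h2 x y z (heq ▸ brace_mem_diHerm k _)
  · have hS := (DiAs.str k X).plus.subset_generatedBy
      (Set.range (DiAs.gen k (X := X)) ∪ dottedTetrads k X ∪ dottedTetradsRepeated k X)
    refine le_antisymm (DiAs.diHerm_le h2 (Dialgebra.isSubdialgebra_generatedBy _ _)
      (fun x => hS (Or.inl (Or.inl ⟨x, rfl⟩))) fun x y z t hyzt hx => ?_) (sInf_le ⟨?_, ?_⟩)
    · rcases hx with rfl | hx
      · exact hS (Or.inr ⟨x, z, t, hyzt, rfl⟩)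
      · exact hS (Or.inl (Or.inr ⟨x, y, z, t, List.nodup_cons.2 ⟨hx, hyzt⟩, rfl⟩))
    · rintro _ ((⟨x, rfl⟩ | ⟨x, y, z, t, -, rfl⟩) | ⟨x, y, z, -, rfl⟩)
      exacts [gen_mem_diHerm k x, brace_mem_diHerm k _, brace_mem_diHerm k _]
    · exact (DiAs.isInvolution k (X := X)).isSubdialgebra
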